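/- Let $(\Omega,\lambda)$ be a nonatomic standard probability space, and let $\mathcal K$ be a simplicial complex on a set $S$, i.e. a collection of nonempty finite subsets (faces) of $S$ such that every nonempty subset of a face is a face. Give $S$ the discrete topology and its Borel $\sigma$-algebra. Let $L(\Omega,S)$ be the set of measurable maps $f:\Omega\to S$ modulo almost everywhere equality, with the metric $d(f,g)=\lambda(\{\omega: f(\omega)\neq g(\omega)\})$; let $L(\Omega,\mathcal K)\subset L(\Omega,S)$ be the set of those $f$ with $\{s\in S:\lambda(f^{-1}(\{s\}))>0\}\in\mathcal K$, and let $\bar L(\Omega,\mathcal K)$ be its closure in $L(\Omega,S)$. Let $|\mathcal K|_1$ be the set of functions $\alpha:S\to[0,1]$ with $\sum_{s}\alpha(s)=1$ and $\mathrm{supp}(\alpha)=\{s:\alpha(s)\neq0\}\in\mathcal K$, with the metric $|\alpha-\beta|_1=\sum_{s}|\alpha(s)-\beta(s)|$, and let $\overline{|\mathcal K|_1}$ be its completion, i.e. the set of functions $\alpha:S\to[0,1]$ with $\sum_s\alpha(s)=1$ all of whose nonempty finite subsets of $\mathrm{supp}(\alpha)$ belong to $\mathcal K$, with the same metric. The law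 maps $$\Psi_{\mathcal K}:L(\Omega,\mathcal K)\to|\mathcal K|_1,\qquad \bar\Psi_{\mathcal K}:\bar L(\Omega,\mathcal K)\to\overline{|\mathcal K|_1}$$ both send $f$ to $s\mapsto\lambda(f^{-1}(\{s\}))$. A continuous map $p:E\to B$ has the homotopy lifting property with respect to a space $X$ if for all continuous $H:X\times[0,1]\to B$ and $h:X\to E$ with $p\circ h=H(\cdot,0)$ there is a continuous $\tilde H:X\times[0,1]\to E$ with $p\circ\tilde H=H$ and $\tilde H(\cdot,0)=h$. It is a Hurewicz fibration if this holds for all topological spaces $X$, and a Serre fibration if this holds for all spheres $S^n$, $n\ge 0$ (equivalently, for all CW-complexes). **Theorem.** For every simplicial complex $\mathcal K$, the maps $\Psi_{\mathcal K}$ and $\bar\Psi_{\mathcal K}$ are Serre fibrations and weak homotopy equivalences. If $\mathcal K$ is finite, then $\Psi_{\mathcal K}$ and $\bar\Psi_{\mathcal K}$ are Hurewicz fibrations and homotopy equivalences. -/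

import Mathlib

open MeasureTheory

universe u v w

namespace SimplicialRV

/-! ### Random variables with values in a discrete set -/

section RandomVariables

variable {Ω : Type u} [mΩ : MeasurableSpace Ω]

/-- Almost everywhere equality of measurable maps `Ω → S`, where the discrete set `S` carries the
σ-algebra of all its subsets (the Borel σ-algebra of the discrete topology). -/
def aeSetoid (μ : Measure Ω) (S : Type v) : Setoid {f : Ω → S // Measurable[mΩ, ⊤] f} where
  r f g := f.1 =ᵐ[μ] g.1
  iseqv := ⟨fun _ => Filter.EventuallyEq.rfl, fun h => h.symm, fun h h' => h.trans h'⟩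

/-- The set `L(Ω, S)` of random variables: measurable maps `Ω → S` up to a.e. equality. -/
def RV (μ : Measure Ω) (S : Type v) : Type (max u v) := Quotient (aeSetoid μ S)

variable {μ : Measure Ω} {S : Type v}

/-- The class of a measurable map in `L(Ω, S)`. -/
def RV.mk (μ : Measure Ω) (f : Ω → S) (hf : Measurable[mΩ, ⊤] f) : RV μ S :=
  Quotient.mk (aeSetoid μ S) ⟨f, hf⟩

/-- The distance `d(f, g) = μ {ω | f ω ≠ g ω}` on `L(Ω, S)`. -/
noncomputable def RV.distance : RV μ S → RV μ S → ℝ :=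
  Quotient.lift₂ (fun f g => μ.real {ω | f.1 ω ≠ g.1 ω}) (by
    intro f g f' g' hf hg
    refine measureReal_congr ?_
    filter_upwards [hf, hg] with ω h1 h2
    exact propext (by
      change f.1 ω ≠ g.1 ω ↔ f'.1 ω ≠ g'.1 ω
      rw [h1, h2]))

noncomputable instance RV.instMetricSpace [IsProbabilityMeasure μ] : MetricSpace (RV μ S) where
  dist := RV.distance
  dist_self x := by
    induction x using Quotient.inductionOn with
    | h f => simp [RV.distance]
  dist_comm x y := by
    induction x, y using Quotient.inductionOn₂ with
    | h f g => simp only [RV.distance, Quotient.lift_mk, ne_comm]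
  dist_triangle x y z := by
    induction x, y, z using Quotient.inductionOn₃ with
    | h f g k =>
      refine le_trans (measureReal_mono ?_) (measureReal_union_le _ _)
      intro ω hω
      by_contra hc
      simp only [Set.mem_union, Set.mem_ofPred_eq, not_or, not_not] at hc
      exact hω (hc.1.trans hc.2)
  eq_of_dist_eq_zero {x y} := by
    induction x, y using Quotient.inductionOn₂ with
    | h f g =>
      intro h0
      refine Quotient.sound ?_
      have h1 : μ.real {ω | f.1 ω ≠ g.1 ω} = 0 := h0
      exact ae_iff.2 ((measureReal_eq_zero_iff).1 h1)

/-- The mass function `s ↦ μ (f ⁻¹ {s})` of a random variable. -/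
noncomputable def RV.mass : RV μ S → S → ℝ :=
  Quotient.lift (fun f s => μ.real (f.1 ⁻¹' {s})) (by
    intro f g h
    funext s
    refine measureReal_congr ?_
    filter_upwards [h] with ω h1
    exact propext (by
      change f.1 ω = s ↔ g.1 ω = s
      rw [h1]))

/-- The essential image `f(Ω) = {s | μ (f ⁻¹ {s}) > 0}`. -/
def RV.essImage (f : RV μ S) : Set S := {s | 0 < f.mass s}

end RandomVariables

/-! ### Essential countability

A measurable map from a standard Borel probability space to a discrete set, of any cardinality, is
concentrated on a countable set. Hence the mass function of a random variable sums to `1`. -/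

section EssCountable

open Set Cardinal

theorem essCountable {Ω : Type*} [mΩ : MeasurableSpace Ω] [StandardBorelSpace Ω]
    (μ : Measure Ω) [IsFiniteMeasure μ] {S : Type*} (f : Ω → S)
    (hf : Measurable[mΩ, ⊤] f) :
    {s | 0 < μ (f ⁻¹' {s})}.Countable ∧ μ (f ⁻¹' {s | 0 < μ (f ⁻¹' {s})}ᶜ) = 0 := by
  have hpre : ∀ A : Set S, MeasurableSet (f ⁻¹' A) := fun A => hf trivial
  refine ⟨Measure.countable_meas_pos_of_disjoint_iUnion (fun s => hpre {s})
    (fun s t hst => Disjoint.preimage f (disjoint_singleton.mpr hst)), ?_⟩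
  set T : Set S := {s | 0 < μ (f ⁻¹' {s})} with hT
  by_contra hne
  -- an injective recoding of the range of `f` by real numbers
  have hr : ∀ s : range f, ∃ ω, f ω = s.1 := fun s => s.2
  choose r hr using hr
  let h : Ω → ℝ := fun ω => embeddingReal Ω (r ⟨f ω, mem_range_self ω⟩)
  have hh : ∀ ω ω', h ω = h ω' → f ω = f ω' := by
    intro ω ω' e
    have e' := (measurableEmbedding_embeddingReal Ω).injective e
    exact (hr ⟨f ω, mem_range_self ω⟩).symm.trans
      ((congrArg f e').trans (hr ⟨f ω', mem_range_self ω'⟩))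
  have hh' : ∀ B : Set ℝ, MeasurableSet (h ⁻¹' B) := by
    intro B
    have : h ⁻¹' B = f ⁻¹' {s | ∃ hs : s ∈ range f, embeddingReal Ω (r ⟨s, hs⟩) ∈ B} := by
      ext ω; simp [h]
    rw [this]; exact hpre _
  have hmeas : Measurable h := fun B _ => hh' B
  -- the range of `h` contains an uncountable compact set
  let up := upgradeStandardBorel Ω
  obtain ⟨t', ht', hcont, hpol⟩ := hmeas.exists_continuous
  obtain ⟨C, hCT, hC, hμC⟩ : ∃ C : Set Ω, C ⊆ f ⁻¹' Tᶜ ∧ @IsCompact Ω t' C ∧ 0 < μ C := by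
    have hb : @BorelSpace Ω t' _ := by
      refine @BorelSpace.mk Ω t' _ ?_
      rw [borel_eq_borel_of_le hpol up.toPolishSpace ht']
      exact BorelSpace.measurable_eq
    let _ := t'
    exact (hpre Tᶜ).exists_lt_isCompact (pos_iff_ne_zero.mpr hne)
  have hK : IsCompact (h '' C) := by
    let _ := t'
    exact hC.image hcont
  have hunc : ¬ (h '' C).Countable := by
    intro hc
    refine hμC.ne' ?_
    have hsub : C ⊆ ⋃ y ∈ h '' C, (C ∩ h ⁻¹' {y}) := by
      intro ω hω
      simp only [mem_iUnion]
      exact ⟨h ω, mem_image_of_mem h hω, hω, rfl⟩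
    refine measure_mono_null hsub ((measure_biUnion_null_iff hc).2 ?_)
    rintro _ ⟨ω, hω, rfl⟩
    have h0 : μ (f ⁻¹' {f ω}) = 0 := by
      have := hCT hω
      simpa [T] using this
    exact measure_mono_null (fun ω' hω' => hh _ _ hω'.2) h0
  obtain ⟨φ, hφ, -, hφi⟩ := hK.isClosed.exists_nat_bool_injection_of_not_countable hunc
  -- too many measurable sets
  have hinj : Function.Injective (fun A : Set (ℕ → Bool) =>
      (⟨h ⁻¹' (φ '' A), hh' _⟩ : {t : Set Ω | MeasurableSet t})) := by
    intro A B hAB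
    have hAB' : h ⁻¹' (φ '' A) = h ⁻¹' (φ '' B) := congrArg Subtype.val hAB
    have hsub : ∀ D : Set (ℕ → Bool), φ '' D ⊆ range h := fun D =>
      (image_subset_range φ D).trans (hφ.trans (image_subset_range h C))
    exact hφi.image_injective
      ((preimage_eq_preimage' (hsub A) (hsub B)).1 hAB')
  have hle := Cardinal.lift_mk_le_lift_mk_of_injective hinj
  have hcard : #{t : Set Ω | MeasurableSet t} ≤ 𝔠 := by
    have h1 : #(MeasurableSpace.countableGeneratingSet Ω) ≤ 𝔠 :=
      ((Cardinal.le_aleph0_iff_set_countable.2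
        MeasurableSpace.countable_countableGeneratingSet)).trans aleph0_le_continuum
    have h2 := MeasurableSpace.cardinal_measurableSet_le_continuum h1
    rwa [MeasurableSpace.generateFrom_countableGeneratingSet] at h2
  have h3 : #(Set (ℕ → Bool)) = 2 ^ 𝔠 := by simp
  rw [h3] at hle
  have h4 := hle.trans (Cardinal.lift_le.2 hcard)
  simp only [lift_power, lift_continuum, lift_two] at h4
  exact absurd h4 (not_le.2 (cantor _))

end EssCountable

theorem hasSum_mass {Ω : Type u} [mΩ : MeasurableSpace Ω] [StandardBorelSpace Ω]
    {μ : Measure Ω} [IsProbabilityMeasure μ] {S : Type v} (f : RV μ S) : HasSum f.mass 1 := by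
  induction f using Quotient.inductionOn with
  | h f =>
    obtain ⟨f, hf⟩ := f
    obtain ⟨hc, h0⟩ := essCountable μ f hf
    set T := {s | 0 < μ (f ⁻¹' {s})} with hT
    have hpre : ∀ A : Set S, MeasurableSet (f ⁻¹' A) := fun A => hf trivial
    have h1 : ∑' s : S, μ (f ⁻¹' {s}) = 1 := by
      have e1 : ∑' s : S, μ (f ⁻¹' {s}) = ∑' s : T, μ (f ⁻¹' {s.1}) := by
        refine (tsum_subtype_eq_of_support_subset ?_).symm
        intro s hs
        exact pos_iff_ne_zero.2 hs
      rw [e1, tsum_measure_preimage_singleton hc (fun s _ => hpre {s})]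
      exact (prob_compl_eq_zero_iff (hpre T)).1 h0
    have hs : ∑' s : S, μ (f ⁻¹' {s}) ≠ ⊤ := by rw [h1]; exact ENNReal.one_ne_top
    have h2 := ENNReal.hasSum_toReal hs
    rw [← ENNReal.tsum_toReal_eq (fun s => measure_ne_top μ _), h1, ENNReal.toReal_one] at h2
    exact h2

/-! ### Probability mass functions on `S` with the `ℓ¹` metric -/

section MassFunctions

variable {S : Type v}

/-- Functions `α : S → [0, 1]` with `∑ s, α s = 1`. -/
def ProbMass (S : Type v) : Type v := {α : S → ℝ // (∀ s, 0 ≤ α s) ∧ HasSum α 1}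

theorem ProbMass.summable_abs_sub (α β : ProbMass S) : Summable fun s => |α.1 s - β.1 s| :=
  (α.2.2.summable.sub β.2.2.summable).abs

/-- The metric `|α - β|₁ = ∑ s, |α s - β s|`. -/
noncomputable instance ProbMass.instMetricSpace : MetricSpace (ProbMass S) where
  dist α β := ∑' s, |α.1 s - β.1 s|
  dist_self α := by simp
  dist_comm α β := by simp only [abs_sub_comm]
  dist_triangle α β γ := by
    rw [← (α.summable_abs_sub β).tsum_add (β.summable_abs_sub γ)]
    exact (α.summable_abs_sub γ).tsum_le_tsum (fun s => abs_sub_le _ _ _)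
      ((α.summable_abs_sub β).add (β.summable_abs_sub γ))
  eq_of_dist_eq_zero {α β} h := by
    refine Subtype.ext (funext fun s => ?_)
    have h0 : |α.1 s - β.1 s| ≤ 0 := by
      have h1 := (α.summable_abs_sub β).le_tsum s (fun t _ => abs_nonneg _)
      exact h1.trans (le_of_eq h)
    exact sub_eq_zero.1 (abs_nonpos_iff.1 h0)

end MassFunctions

/-! ### The spaces attached to a simplicial complex, and the law maps -/

section Law

variable {Ω : Type u} [mΩ : MeasurableSpace Ω] {S : Type v}

/-- `L(Ω, K)`: the random variables whose essential image is a face of `K`. -/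
def spaceL (μ : Measure Ω) (K : PreAbstractSimplicialComplex S) : Set (RV μ S) :=
  {f | ∃ F ∈ K.faces, (F : Set S) = f.essImage}

/-- `L̄(Ω, K)`: the closure of `L(Ω, K)` in `L(Ω, S)`. -/
def spaceLbar (μ : Measure Ω) [IsProbabilityMeasure μ] (K : PreAbstractSimplicialComplex S) :
    Set (RV μ S) :=
  closure (spaceL μ K)

/-- `|K|₁`: mass functions whose support is a face of `K`, with the `ℓ¹` metric. -/
def realization (K : PreAbstractSimplicialComplex S) : Set (ProbMass S) :=
  {α | ∃ F ∈ K.faces, (F : Set S) = {s | α.1 s ≠ 0}}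

/-- The completion of `|K|₁`: mass functions all of whose nonempty finite subsets of the support
are faces of `K`, with the `ℓ¹` metric. -/
def realizationBar (K : PreAbstractSimplicialComplex S) : Set (ProbMass S) :=
  {α | ∀ F : Finset S, F.Nonempty → (F : Set S) ⊆ {s | α.1 s ≠ 0} → F ∈ K.faces}

theorem mass_nonneg {μ : Measure Ω} (f : RV μ S) (s : S) : 0 ≤ f.mass s := by
  induction f using Quotient.inductionOn with
  | h f => exact measureReal_nonneg

theorem mass_le_mass_add_dist {μ : Measure Ω} [IsProbabilityMeasure μ] (f g : RV μ S) (s : S) :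
    f.mass s ≤ g.mass s + dist f g := by
  induction f, g using Quotient.inductionOn₂ with
  | h f g =>
    refine le_trans (measureReal_mono ?_) (measureReal_union_le _ _)
    intro ω hω
    by_cases h : f.1 ω = g.1 ω
    · exact Or.inl (h.symm.trans hω)
    · exact Or.inr h

variable [StandardBorelSpace Ω] (μ : Measure Ω) [IsProbabilityMeasure μ]

/-- The law of a random variable, as a mass function on `S`. -/
noncomputable def law (f : RV μ S) : ProbMass S := ⟨f.mass, mass_nonneg f, hasSum_mass f⟩

theorem law_support (f : RV μ S) : {s | (law μ f).1 s ≠ 0} = f.essImage := by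
  ext s
  exact ⟨fun h => lt_of_le_of_ne (mass_nonneg f s) (Ne.symm h), fun h => ne_of_gt h⟩

theorem mapsTo_law (K : PreAbstractSimplicialComplex S) :
    Set.MapsTo (law μ) (spaceL μ K) (realization K) := by
  rintro f ⟨F, hF, e⟩
  exact ⟨F, hF, e.trans (law_support μ f).symm⟩

theorem mapsTo_law_bar (K : PreAbstractSimplicialComplex S) :
    Set.MapsTo (law μ) (spaceLbar μ K) (realizationBar K) := by
  intro f hf F hne hF
  rw [law_support] at hF
  obtain ⟨m, hm, hmin⟩ := F.exists_min_image f.mass hne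
  obtain ⟨g, ⟨G, hG, e⟩, hd⟩ := Metric.mem_closure_iff.1 hf _ (hF hm)
  refine (K.isRelLowerSet_faces hG).2 ?_ hne
  intro s hs
  have h1 := mass_le_mass_add_dist f g s
  have h2 := hmin s hs
  have h3 : s ∈ g.essImage := by
    change 0 < g.mass s
    linarith
  rw [← e] at h3
  exact h3

/-- The law map `Ψ_K : L(Ω, K) → |K|₁`. -/
noncomputable def lawMap (K : PreAbstractSimplicialComplex S) : spaceL μ K → realization K :=
  (mapsTo_law μ K).restrict

/-- The law map `Ψ̄_K` from `L̄(Ω, K)` to the completion of `|K|₁`. -/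
noncomputable def lawMapBar (K : PreAbstractSimplicialComplex S) :
    spaceLbar μ K → realizationBar K :=
  (mapsTo_law_bar μ K).restrict

end Law

/-! ### Fibrations and homotopy equivalences -/

section Homotopy

open scoped unitInterval Topology

variable {E : Type u} {B : Type v} [TopologicalSpace E] [TopologicalSpace B]

/-- The homotopy lifting property of `p` with respect to `X`. -/
def HasHLP (p : E → B) (X : Type w) [TopologicalSpace X] : Prop :=
  ∀ (H : C(X × I, B)) (h : C(X, E)), (∀ x, p (h x) = H (x, 0)) →
    ∃ G : C(X × I, E), (∀ z, p (G z) = H z) ∧ ∀ x, G (x, 0) = h x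

/-- A Hurewicz fibration: a continuous map with the homotopy lifting property with respect to all
topological spaces. -/
def IsHurewiczFibration (p : E → B) : Prop :=
  Continuous p ∧ ∀ (X : Type w) [TopologicalSpace X], HasHLP p X

/-- A Serre fibration: a continuous map with the homotopy lifting property with respect to all
spheres `Sⁿ`, `n ≥ 0`. As the disc `Dⁿ` is a retract of `Sⁿ`, this amounts to the homotopy lifting
property with respect to all discs, or to all CW-complexes. -/
def IsSerreFibration (p : E → B) : Prop :=
  Continuous p ∧ ∀ n : ℕ, HasHLP p (Metric.sphere (0 : EuclideanSpace ℝ (Fin (n + 1))) 1)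

/-- The map induced on sets of path components. -/
def pi0Map (p : C(E, B)) : ZerothHomotopy E → ZerothHomotopy B :=
  ZerothHomotopy.lift (fun x => ZerothHomotopy.mk (p x))
    (fun _ _ γ => ZerothHomotopy.sound (γ.map p.continuous))

/-- The map induced on `π_n`, by composition of maps of pairs `(Iⁿ, ∂Iⁿ) → (E, x)` with `p`. -/
def piMap (p : C(E, B)) (n : ℕ) (x : E) : HomotopyGroup.Pi n E x → HomotopyGroup.Pi n B (p x) :=
  Quotient.map' (s₁ := GenLoop.Homotopic.setoid (Fin n) x)
    (s₂ := GenLoop.Homotopic.setoid (Fin n) (p x))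
    (fun γ => ⟨p.comp γ.1, fun y hy => congrArg p (γ.2 y hy)⟩)
    (fun _ _ h => ContinuousMap.HomotopicRel.comp_continuousMap h p)

/-- A weak homotopy equivalence: a continuous map inducing a bijection of path components and
isomorphisms of all homotopy groups at all base points. -/
def IsWeakHomotopyEquiv (p : E → B) : Prop :=
  ∃ hp : Continuous p, Function.Bijective (pi0Map ⟨p, hp⟩) ∧
    ∀ (n : ℕ), 1 ≤ n → ∀ x : E, Function.Bijective (piMap ⟨p, hp⟩ n x)

/-- A homotopy equivalence: a continuous map with a homotopy inverse. -/
def IsHomotopyEquiv (p : E → B) : Prop :=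
  ∃ e : ContinuousMap.HomotopyEquiv E B, ⇑e.toFun = p

end Homotopy

end SimplicialRV

/-! Everything rests on one continuous map `T : L(Ω, S) × ProbMass S → L(Ω, S)`, called `transport`,
with law of `T (f, β)` equal to `β` and `T (f, law f) = f`. A homotopy `H` with initial lift `h` is
then lifted by `T (h x, H (x, t))`. Moreover `L(Ω, S)` contracts to any point `x` keeping `x` fixed;
transporting the contraction `c` back to the original law, `T (c (t, f), law f)`, gives a
deformation over the base onto the section `β ↦ T (x, β)`. Both arguments restrict to `L(Ω, K)` and
its closure because these are full preimages under the law map (`mem_spaceL_of_law`,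
`mem_spaceLbar_of_law`).

To build `T`, choose `U : Ω → (0, 1)` with atomless law. On `{f = s}` the value `s` is kept on an
initial part, with respect to `U`, of measure `min (f.mass s) (β s)`. The remaining set has exactly
the measure by which `β` exceeds the law of `f`; it is sliced along `U` into consecutive pieces, in
a linear order of `S`, and the piece for `s` receives the value `s`. Continuity comes from two
facts: the initial part of measure `a` of a set `R` depends continuously on `(R, a)` in the measure
algebra (`measureReal_cut_diff_le`), and convergence of each level set separately implies
convergence in `L(Ω, S)`, as the limit is concentrated on finitely many values up to `ε`
(`RV.tendsto_of_level`). -/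

namespace SimplicialRV

/-! ### Fibrations and homotopy equivalences from a transport map -/

section Abstract

open scoped unitInterval Topology

variable {E : Type u} {B : Type v} [TopologicalSpace E] [TopologicalSpace B]

/-- A continuous map `T : E × B → E` that moves every point `e` over a prescribed base point `b`,
and does not move `e` if `b = p e`, lifts all homotopies. -/
theorem hasHLP_restrict {p : E → B} {T : E × B → E} (hT : Continuous T)
    (hpT : ∀ e b, p (T (e, b)) = b) (hTp : ∀ e, T (e, p e) = e) {A : Set E} {C : Set B}
    (h : Set.MapsTo p A C) (hA : ∀ e, p e ∈ C → e ∈ A) (X : Type w) [TopologicalSpace X] :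
    HasHLP h.restrict X := by
  intro H g hg
  refine ⟨⟨fun z => ⟨T ((g z.1).1, (H z).1), hA _ (by rw [hpT]; exact (H z).2)⟩, ?_⟩, ?_, ?_⟩
  · fun_prop
  · intro z
    exact Subtype.ext (hpT _ _)
  · intro x
    refine Subtype.ext ?_
    have : (H (x, 0)).1 = p (g x).1 := (congrArg Subtype.val (hg x)).symm
    change T ((g x).1, (H (x, 0)).1) = (g x).1
    rw [this, hTp]

/-- For every point `x` of the source, `p` has a section through `x`, and the source contracts to
the image of this section by a deformation over the base that fixes `x`. -/
def HasPointedDeformation (p : E → B) : Prop :=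
  ∀ x : E, ∃ (r : C(B, E)) (D : C(I × E, E)), (∀ b, p (r b) = b) ∧ r (p x) = x ∧
    (∀ e, D (0, e) = e) ∧ (∀ e, D (1, e) = r (p e)) ∧ ∀ t, D (t, x) = x

/-- The contraction `c` of the ambient space preserves neither the fibres of `p` nor `A`; applying
`T (·, p e)` to `c (t, e)` returns it to the fibre of `e`, and at `t = 1` yields the section `b ↦ T
(x, b)`. -/
theorem hasPointedDeformation_restrict {p : E → B} (hp : Continuous p) {T : E × B → E}
    (hT : Continuous T) (hpT : ∀ e b, p (T (e, b)) = b) (hTp : ∀ e, T (e, p e) = e)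
    (hc : ∀ x : E, ∃ c : C(I × E, E), (∀ e, c (0, e) = e) ∧ (∀ e, c (1, e) = x) ∧
      ∀ t, c (t, x) = x)
    {A : Set E} {C : Set B} (h : Set.MapsTo p A C) (hA : ∀ e, p e ∈ C → e ∈ A) :
    HasPointedDeformation h.restrict := by
  intro x
  obtain ⟨c, hc0, hc1, hcx⟩ := hc x.1
  refine ⟨⟨fun b => ⟨T (x.1, b.1), hA _ (by rw [hpT]; exact b.2)⟩, by fun_prop⟩,
    ⟨fun z => ⟨T (c (z.1, z.2.1), p z.2.1), hA _ (by rw [hpT]; exact h z.2.2)⟩, by fun_prop⟩,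
    fun b => Subtype.ext (hpT _ _), Subtype.ext (hTp _), fun e => Subtype.ext ?_,
    fun e => Subtype.ext ?_, fun t => Subtype.ext ?_⟩
  · change T (c (0, e.1), p e.1) = e.1
    rw [hc0, hTp]
  · change T (c (1, e.1), p e.1) = T (x.1, p e.1)
    rw [hc1]
  · change T (c (t, x.1), p x.1) = x.1
    rw [hcx, hTp]

theorem HasPointedDeformation.isHomotopyEquiv {p : E → B} (h : HasPointedDeformation p)
    (hp : Continuous p) (hB : Nonempty B → Nonempty E) : IsHomotopyEquiv p := by
  by_cases hE : Nonempty E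
  · obtain ⟨x⟩ := hE
    obtain ⟨r, D, hr, -, hD0, hD1, -⟩ := h x
    refine ⟨⟨⟨p, hp⟩, r, ContinuousMap.Homotopic.symm ⟨⟨D, hD0, hD1⟩⟩, ?_⟩, rfl⟩
    have : (⟨p, hp⟩ : C(E, B)).comp r = ContinuousMap.id B := ContinuousMap.ext hr
    rw [this]
  · have hB' : IsEmpty B := not_nonempty_iff.1 fun hb => hE (hB hb)
    have hE' : IsEmpty E := not_nonempty_iff.1 hE
    refine ⟨⟨⟨p, hp⟩, ⟨fun b => hB'.elim b, continuous_of_discreteTopology⟩, ?_, ?_⟩, rfl⟩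
    · have : (⟨fun b => hB'.elim b, continuous_of_discreteTopology⟩ : C(B, E)).comp ⟨p, hp⟩ =
        ContinuousMap.id E := ContinuousMap.ext fun e => hE'.elim e
      rw [this]
    · have : (⟨p, hp⟩ : C(E, B)).comp ⟨fun b => hB'.elim b, continuous_of_discreteTopology⟩ =
        ContinuousMap.id B := ContinuousMap.ext fun e => hB'.elim e
      rw [this]

/-- The section `r` through `x` respects base points, so `p ∘ r = id` gives surjectivity on `π_n`.
Since `D` fixes `x`, it is a homotopy relative to the boundary of the cube from `c` to `r ∘ p ∘ c`,
which gives injectivity. -/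
theorem HasPointedDeformation.isWeakHomotopyEquiv {p : E → B} (h : HasPointedDeformation p)
    (hp : Continuous p) (hB : Nonempty B → Nonempty E) : IsWeakHomotopyEquiv p := by
  refine ⟨hp, ⟨?_, ?_⟩, fun n _ x => ⟨?_, ?_⟩⟩
  · intro a b hab
    obtain ⟨a, rfl⟩ := ZerothHomotopy.mk_surjective a
    obtain ⟨b, rfl⟩ := ZerothHomotopy.mk_surjective b
    obtain ⟨r, D, hr, -, hD0, hD1, -⟩ := h a
    have hab' : Joined (p a) (p b) := Quotient.exact hab
    have hD : ∀ e, Joined e (r (p e)) := fun e =>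
      ⟨⟨⟨fun t => D (t, e), by fun_prop⟩, hD0 e, hD1 e⟩⟩
    exact Quotient.sound (((hD a).trans (hab'.map r.continuous)).trans (hD b).symm)
  · intro b
    obtain ⟨b, rfl⟩ := ZerothHomotopy.mk_surjective b
    obtain ⟨x⟩ := hB ⟨b⟩
    obtain ⟨r, -, hr, -⟩ := h x
    exact ⟨ZerothHomotopy.mk (r b), congrArg ZerothHomotopy.mk (hr b)⟩
  · obtain ⟨r, D, hr, hrx, hD0, hD1, hDx⟩ := h x
    intro a b
    induction a, b using Quotient.inductionOn₂ with
    | h a b =>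
      intro hab
      have hab' : ContinuousMap.HomotopicRel ((⟨p, hp⟩ : C(E, B)).comp a.1)
        ((⟨p, hp⟩ : C(E, B)).comp b.1) (Cube.boundary (Fin n)) := Quotient.exact hab
      have hD : ∀ c : GenLoop (Fin n) E x, ContinuousMap.HomotopicRel c.1
          (r.comp ((⟨p, hp⟩ : C(E, B)).comp c.1)) (Cube.boundary (Fin n)) := fun c =>
        ⟨⟨⟨D.comp ⟨fun z => (z.1, c.1 z.2), by fun_prop⟩, fun y => hD0 _, fun y => hD1 _⟩,
          fun t y hy => by
            have hy' : c.1 y = x := c.2 y hy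
            change D (t, c.1 y) = c.1 y
            rw [hy', hDx]⟩⟩
      exact Quotient.sound (((hD a).trans (hab'.comp_continuousMap r)).trans (hD b).symm)
  · obtain ⟨r, -, hr, hrx, -⟩ := h x
    intro b
    induction b using Quotient.inductionOn with
    | h b =>
      refine ⟨Quotient.mk _ ⟨r.comp b.1, fun y hy => ?_⟩, ?_⟩
      · exact (congrArg r (b.2 y hy)).trans hrx
      · refine congrArg (Quotient.mk _) (Subtype.ext (ContinuousMap.ext fun y => ?_))
        exact hr (b.1 y)

end Abstract

/-! ### Convergence of measurable sets -/

section MeasurableSets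

open Set Filter
open scoped Topology symmDiff

variable {Ω : Type u} [MeasurableSpace Ω] {μ : Measure Ω} {X : Type*} {l : Filter X}

theorem measureReal_sub_le_symmDiff [IsProbabilityMeasure μ] (A B : Set Ω) : μ.real A - μ.real B ≤ μ.real (A ∆ B) := by
  have h : A ⊆ A ∆ B ∪ B := fun ω hω => by
    by_cases hB : ω ∈ B
    · exact Or.inr hB
    · exact Or.inl (Or.inl ⟨hω, hB⟩)
  have := (measureReal_mono (μ := μ) h).trans (measureReal_union_le _ _)
  linarith

/-- Convergence of sets in the measure algebra. -/
def SetTendsto (μ : Measure Ω) (A : X → Set Ω) (l : Filter X) (A₀ : Set Ω) : Prop :=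
  Tendsto (fun x => μ.real (A x ∆ A₀)) l (𝓝 0)

theorem tendsto_measureReal_zero_of_subset [IsProbabilityMeasure μ] {A B : X → Set Ω}
    (h : Tendsto (fun x => μ.real (B x)) l (𝓝 0)) (hAB : ∀ x, A x ⊆ B x) :
    Tendsto (fun x => μ.real (A x)) l (𝓝 0) :=
  squeeze_zero (fun _ => measureReal_nonneg) (fun x => measureReal_mono (hAB x)) h

theorem SetTendsto.of_diff {A : X → Set Ω} {A₀ : Set Ω}
    (h : Tendsto (fun x => μ.real (A x \ A₀)) l (𝓝 0))
    (h' : Tendsto (fun x => μ.real (A₀ \ A x)) l (𝓝 0)) : SetTendsto μ A l A₀ := by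
  refine squeeze_zero (fun _ => measureReal_nonneg) (fun x => measureReal_union_le _ _) ?_
  simpa using h.add h'

theorem SetTendsto.diff_right [IsProbabilityMeasure μ] {A : X → Set Ω} {A₀ : Set Ω} (h : SetTendsto μ A l A₀) :
    Tendsto (fun x => μ.real (A₀ \ A x)) l (𝓝 0) :=
  tendsto_measureReal_zero_of_subset h fun _ => subset_union_right

theorem SetTendsto.union [IsProbabilityMeasure μ] {A B : X → Set Ω} {A₀ B₀ : Set Ω} (hA : SetTendsto μ A l A₀)
    (hB : SetTendsto μ B l B₀) : SetTendsto μ (fun x => A x ∪ B x) l (A₀ ∪ B₀) := by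
  refine squeeze_zero (fun _ => measureReal_nonneg) (fun x =>
    (measureReal_mono union_symmDiff_union_subset).trans (measureReal_union_le _ _)) ?_
  simpa using hA.add hB

theorem SetTendsto.compl {A : X → Set Ω} {A₀ : Set Ω} (hA : SetTendsto μ A l A₀) :
    SetTendsto μ (fun x => (A x)ᶜ) l A₀ᶜ := by
  simpa only [SetTendsto, compl_symmDiff_compl] using hA

theorem SetTendsto.sdiff [IsProbabilityMeasure μ] {A B : X → Set Ω} {A₀ B₀ : Set Ω} (hA : SetTendsto μ A l A₀)
    (hB : SetTendsto μ B l B₀) : SetTendsto μ (fun x => A x \ B x) l (A₀ \ B₀) := by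
  simpa only [compl_union, compl_compl, ← sdiff_eq] using (hA.compl.union hB).compl

end MeasurableSets

/-! ### Initial parts of measurable sets -/

section Cut

open Set Filter
open scoped Topology symmDiff

variable {Ω : Type u} [MeasurableSpace Ω]

/-- A measurable function with values in `(0, 1)` whose law has no atoms. -/
structure DiffuseCoordinate (μ : Measure Ω) where
  /-- the underlying function -/
  toFun : Ω → ℝ
  measurable_toFun : Measurable toFun
  pos : ∀ ω, 0 < toFun ω
  lt_one : ∀ ω, toFun ω < 1
  measure_fiber : ∀ c, μ (toFun ⁻¹' {c}) = 0

/-- A Borel embedding into `ℝ` followed by the sigmoid is injective, so each fibre has at most one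
point and is null. -/
theorem nonempty_diffuseCoordinate [StandardBorelSpace Ω] (μ : Measure Ω) [NullSingletonClass μ] :
    Nonempty (DiffuseCoordinate μ) := by
  refine ⟨⟨fun ω => Real.sigmoid (embeddingReal Ω ω),
    continuous_sigmoid.measurable.comp (measurableEmbedding_embeddingReal Ω).measurable,
    fun ω => Real.sigmoid_pos _, fun ω => Real.sigmoid_lt_one _, fun c => ?_⟩⟩
  refine Set.Subsingleton.measure_zero (fun ω hω ω' hω' => ?_) μ
  exact (measurableEmbedding_embeddingReal Ω).injective
    (Real.sigmoid_injective (hω.trans hω'.symm))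

namespace DiffuseCoordinate

variable {μ : Measure Ω} (U : DiffuseCoordinate μ)

theorem measurableSet_le (τ : ℝ) : MeasurableSet (U.toFun ⁻¹' Iic τ) :=
  U.measurable_toFun measurableSet_Iic

/-- A level `τ` such that `R ∩ {U ≤ τ}` has measure `a`. -/
noncomputable def threshold (R : Set Ω) (a : ℝ) : ℝ :=
  Classical.epsilon fun τ => μ.real (R ∩ U.toFun ⁻¹' Iic τ) = a

/-- The initial part of measure `a` of the set `R` with respect to the coordinate `U`. -/
noncomputable def cut (R : Set Ω) (a : ℝ) : Set Ω := R ∩ U.toFun ⁻¹' Iic (U.threshold R a)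

theorem measurableSet_cut {R : Set Ω} (hR : MeasurableSet R) (a : ℝ) :
    MeasurableSet (U.cut R a) :=
  hR.inter (U.measurableSet_le _)

theorem cut_subset (R : Set Ω) (a : ℝ) : U.cut R a ⊆ R := inter_subset_left

variable [IsProbabilityMeasure μ]

/-- As `U > 0`, this is the integral of `1` over `(0, τ]` for the law of `U` on `R`, a finite
measure without atoms. -/
theorem continuousOn_measureReal_inter (R : Set Ω) :
    ContinuousOn (fun τ => μ.real (R ∩ U.toFun ⁻¹' Iic τ)) (Icc 0 1) := by
  set ν := (μ.restrict R).map U.toFun with hν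
  have : NullSingletonClass ν := ⟨fun c => by
    rw [hν, Measure.map_apply U.measurable_toFun (measurableSet_singleton c)]
    exact le_antisymm ((Measure.restrict_apply_le R _).trans (U.measure_fiber c).le) bot_le⟩
  have hf : IsFiniteMeasure ν := by rw [hν]; infer_instance
  have h := intervalIntegral.continuous_primitive (μ := ν) (f := fun _ => (1 : ℝ))
    (fun a b => intervalIntegrable_const) 0
  refine h.continuousOn.congr fun τ hτ => ?_
  beta_reduce
  rw [intervalIntegral.integral_const', Ioc_eq_empty (not_lt.2 hτ.1), measureReal_empty, sub_zero,
    smul_eq_mul, mul_one, hν, map_measureReal_apply U.measurable_toFun measurableSet_Ioc,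
    measureReal_restrict_apply (U.measurable_toFun measurableSet_Ioc), inter_comm]
  congr 1
  ext ω
  simp [U.pos ω]

theorem exists_threshold {R : Set Ω} {a : ℝ} (h0 : 0 ≤ a)
    (h1 : a ≤ μ.real R) : ∃ τ, μ.real (R ∩ U.toFun ⁻¹' Iic τ) = a := by
  have e0 : R ∩ U.toFun ⁻¹' Iic 0 = ∅ :=
    eq_empty_of_forall_notMem fun ω hω => not_lt.2 hω.2 (U.pos ω)
  have e1 : R ∩ U.toFun ⁻¹' Iic 1 = R :=
    inter_eq_left.2 fun ω _ => (U.lt_one ω).le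
  obtain ⟨τ, -, hτ⟩ := intermediate_value_Icc zero_le_one (U.continuousOn_measureReal_inter R)
    (show a ∈ Icc _ _ by simp only [e0, e1, measureReal_empty]; exact ⟨h0, h1⟩)
  exact ⟨τ, hτ⟩

variable {U}

theorem measureReal_cut {R : Set Ω} {a : ℝ} (h0 : 0 ≤ a)
    (h1 : a ≤ μ.real R) : μ.real (U.cut R a) = a :=
  Classical.epsilon_spec (U.exists_threshold h0 h1)

/-- No continuity of the thresholds is needed. If the first threshold is the smaller one, the
difference lies in `R \ R'`. Otherwise the opposite difference lies in `R' \ R`, and the measures of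
the two differences differ by `a - a'`. -/
theorem measureReal_cut_diff_le {R R' : Set Ω} (hR : MeasurableSet R) (hR' : MeasurableSet R')
    {a a' : ℝ} (h0 : 0 ≤ a) (h1 : a ≤ μ.real R) (h0' : 0 ≤ a') (h1' : a' ≤ μ.real R') :
    μ.real (U.cut R a \ U.cut R' a') ≤ μ.real (R ∆ R') + |a - a'| := by
  rcases le_total (U.threshold R a) (U.threshold R' a') with h | h
  · refine (measureReal_mono (μ := μ) ?_).trans (le_add_of_nonneg_right (abs_nonneg _))
    exact fun ω hω => Or.inl ⟨hω.1.1, fun hω' => hω.2 ⟨hω', hω.1.2.trans h⟩⟩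
  · have e := measureReal_sdiff_add_inter (μ := μ) (s := U.cut R a) (U.measurableSet_cut hR' a')
    have e' := measureReal_sdiff_add_inter (μ := μ) (s := U.cut R' a') (U.measurableSet_cut hR a)
    rw [measureReal_cut h0 h1] at e
    rw [measureReal_cut h0' h1', inter_comm] at e'
    have hd : μ.real (U.cut R' a' \ U.cut R a) ≤ μ.real (R ∆ R') :=
      measureReal_mono fun ω hω => Or.inr ⟨hω.1.1, fun hω' => hω.2 ⟨hω', hω.1.2.trans h⟩⟩
    linarith [le_abs_self (a - a')]

theorem cut_mono {R : Set Ω} {a b : ℝ} (h0 : 0 ≤ a) (hab : a ≤ b)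
    (h1 : b ≤ μ.real R) : U.cut R a ⊆ U.cut R b := by
  rcases le_or_gt (U.threshold R a) (U.threshold R b) with h | h
  · exact fun ω hω => ⟨hω.1, hω.2.trans h⟩
  -- The reverse inclusion forces `b ≤ a`, so `a = b` and the two cuts coincide.
  · have hs : U.cut R b ⊆ U.cut R a := fun ω hω => ⟨hω.1, hω.2.trans h.le⟩
    have := measureReal_mono (μ := μ) hs
    rw [measureReal_cut h0 (hab.trans h1), measureReal_cut (h0.trans hab) h1] at this
    rw [le_antisymm hab this]

theorem setTendsto_cut {X : Type*} {l : Filter X} {R : X → Set Ω} {R₀ : Set Ω} {a : X → ℝ} {a₀ : ℝ}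
    (hR : ∀ x, MeasurableSet (R x)) (hR₀ : MeasurableSet R₀) (h0 : ∀ x, 0 ≤ a x)
    (h1 : ∀ x, a x ≤ μ.real (R x)) (h0' : 0 ≤ a₀) (h1' : a₀ ≤ μ.real R₀)
    (hl : SetTendsto μ R l R₀) (ha : Tendsto a l (𝓝 a₀)) :
    SetTendsto μ (fun x => U.cut (R x) (a x)) l (U.cut R₀ a₀) := by
  have hs : Tendsto (fun x => μ.real (R x ∆ R₀) + |a x - a₀|) l (𝓝 0) := by
    simpa using Tendsto.add hl (ha.sub_const a₀).abs
  refine SetTendsto.of_diff ?_ ?_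
  · exact squeeze_zero (fun _ => measureReal_nonneg)
      (fun x => measureReal_cut_diff_le (hR x) hR₀ (h0 x) (h1 x) h0' h1') hs
  · refine squeeze_zero (fun _ => measureReal_nonneg) (fun x => ?_) hs
    rw [symmDiff_comm, abs_sub_comm]
    exact measureReal_cut_diff_le hR₀ (hR x) h0' h1' (h0 x) (h1 x)

end DiffuseCoordinate

end Cut

/-! ### Level sets of random variables -/

section Levels

open Set Filter
open scoped Topology symmDiff

variable {Ω : Type u} [MeasurableSpace Ω] {μ : Measure Ω} {S : Type v}

/-- A measurable function representing a random variable. -/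
noncomputable def RV.rep (f : RV μ S) : Ω → S := (Quotient.out (s := aeSetoid μ S) f).1

/-- The set where a random variable takes the value `s`. -/
def RV.level (f : RV μ S) (s : S) : Set Ω := f.rep ⁻¹' {s}

theorem RV.measurable_rep (f : RV μ S) : Measurable[_, ⊤] f.rep :=
  (Quotient.out (s := aeSetoid μ S) f).2

theorem RV.measurableSet_level (f : RV μ S) (s : S) : MeasurableSet (f.level s) :=
  f.measurable_rep trivial

theorem RV.mk_rep (f : RV μ S) : RV.mk μ f.rep f.measurable_rep = f := Quotient.out_eq f

theorem RV.rep_mk {f : Ω → S} (hf : Measurable[_, ⊤] f) : (RV.mk μ f hf).rep =ᵐ[μ] f :=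
  Quotient.mk_out (s := aeSetoid μ S) _

theorem RV.mass_eq (f : RV μ S) (s : S) : f.mass s = μ.real (f.level s) := by
  conv_lhs => rw [← f.mk_rep]
  rfl

theorem RV.disjoint_level (f : RV μ S) {s t : S} (h : s ≠ t) : Disjoint (f.level s) (f.level t) :=
  Disjoint.preimage _ (disjoint_singleton.2 h)

variable [IsProbabilityMeasure μ]

theorem RV.dist_eq (f g : RV μ S) : dist f g = μ.real {ω | f.rep ω ≠ g.rep ω} := by
  conv_lhs => rw [← f.mk_rep, ← g.mk_rep]
  rfl

theorem RV.dist_mk {f g : Ω → S} (hf : Measurable[_, ⊤] f) (hg : Measurable[_, ⊤] g) :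
    dist (RV.mk μ f hf) (RV.mk μ g hg) = μ.real {ω | f ω ≠ g ω} := rfl

theorem RV.setTendsto_level {X : Type*} {l : Filter X} {f : X → RV μ S} {f₀ : RV μ S}
    (h : Tendsto f l (𝓝 f₀)) (s : S) : SetTendsto μ (fun x => (f x).level s) l (f₀.level s) := by
  rw [tendsto_iff_dist_tendsto_zero] at h
  simp only [RV.dist_eq] at h
  refine tendsto_measureReal_zero_of_subset h fun x ω hω he => ?_
  rcases hω with ⟨h1, h2⟩ | ⟨h1, h2⟩
  · exact h2 (he.symm.trans h1)
  · exact h2 (Eq.trans he h1)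

theorem RV.sum_inter_level (f : RV μ S) {A : Set Ω} (F : Finset S) :
    ∑ s ∈ F, μ.real (A ∩ f.level s) = μ.real (A ∩ f.rep ⁻¹' F) := by
  have h := sum_measureReal_preimage_singleton (μ := μ.restrict A) F (f := f.rep)
    (fun s _ => f.measurableSet_level s)
  rw [measureReal_restrict_apply (f.measurable_rep trivial), inter_comm] at h
  rw [← h]
  refine Finset.sum_congr rfl fun s _ => ?_
  rw [measureReal_restrict_apply (f.measurable_rep trivial), inter_comm]
  rfl

theorem RV.sum_mass (f : RV μ S) (F : Finset S) : ∑ s ∈ F, f.mass s = μ.real (f.rep ⁻¹' F) := by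
  simpa [RV.mass_eq] using f.sum_inter_level (A := univ) F

variable [StandardBorelSpace Ω]

/-- The masses sum to `1`, so finitely many values carry all but `ε` of `Ω`, even if `S` is
uncountable. -/
theorem RV.tendsto_compl (f : RV μ S) :
    Tendsto (fun F : Finset S => μ.real (f.rep ⁻¹' F)ᶜ) atTop (𝓝 0) := by
  have h := (tendsto_const_nhds (x := (1 : ℝ))).sub (hasSum_mass f)
  rw [sub_self] at h
  refine h.congr fun F => ?_
  rw [f.sum_mass, probReal_compl_eq_one_sub (f.measurable_rep trivial)]

theorem RV.hasSum_inter_level (f : RV μ S) (A : Set Ω) :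
    HasSum (fun s => μ.real (A ∩ f.level s)) (μ.real A) := by
  have h := (tendsto_const_nhds (x := μ.real A)).sub
    (tendsto_measureReal_zero_of_subset f.tendsto_compl
      (A := fun F : Finset S => A \ f.rep ⁻¹' F) (fun F ω hω => hω.2))
  rw [sub_zero] at h
  refine h.congr fun F => ?_
  rw [f.sum_inter_level, sub_eq_iff_eq_add, add_comm,
    measureReal_sdiff_add_inter (f.measurable_rep trivial)]

/-- Sets have small measure if their traces on all level sets of a random variable do. -/
theorem RV.tendsto_measureReal_zero {X : Type*} {l : Filter X} (f : RV μ S) {B : X → Set Ω}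
    (h : ∀ s, Tendsto (fun x => μ.real (B x ∩ f.level s)) l (𝓝 0)) :
    Tendsto (fun x => μ.real (B x)) l (𝓝 0) := by
  refine tendsto_order.2 ⟨fun a ha => Eventually.of_forall fun x =>
    ha.trans_le measureReal_nonneg, fun ε hε => ?_⟩
  obtain ⟨F, hF⟩ := ((tendsto_order.1 f.tendsto_compl).2 (ε / 2) (half_pos hε)).exists
  have hs : Tendsto (fun x => ∑ s ∈ F, μ.real (B x ∩ f.level s)) l (𝓝 0) := by
    simpa using tendsto_finsetSum F fun s _ => h s
  filter_upwards [(tendsto_order.1 hs).2 (ε / 2) (half_pos hε)] with x hx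
  rw [f.sum_inter_level] at hx
  have h1 : μ.real (B x \ f.rep ⁻¹' F) ≤ μ.real (f.rep ⁻¹' F)ᶜ := measureReal_mono fun ω hω => hω.2
  have h2 := measureReal_sdiff_add_inter (μ := μ) (s := B x) (t := f.rep ⁻¹' F)
    (f.measurable_rep trivial)
  linarith

/-- On `{f₀ = s}` the two variables differ only outside the level set of `f x` at `s`. No uniformity
in `s` is required, because `f₀` is concentrated on finitely many values up to `ε`. -/
theorem RV.tendsto_of_level {X : Type*} {l : Filter X} {f : X → RV μ S} {f₀ : RV μ S}
    (h : ∀ s, SetTendsto μ (fun x => (f x).level s) l (f₀.level s)) : Tendsto f l (𝓝 f₀) := by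
  rw [tendsto_iff_dist_tendsto_zero]
  simp only [RV.dist_eq]
  refine f₀.tendsto_measureReal_zero fun s => ?_
  refine tendsto_measureReal_zero_of_subset (h s).diff_right fun x ω hω => ?_
  have h2 : f₀.rep ω = s := hω.2
  exact ⟨h2, fun h1 => hω.1 (Eq.trans h1 h2.symm)⟩

/-- The level sets at `s` differ only within the parts of `D` where `f = s` or `g = s`; summed over
`s`, each kind contributes at most `μ D`. -/
theorem dist_law_le (f g : RV μ S) : dist (law μ f) (law μ g) ≤ 2 * dist f g := by
  set D := {ω | f.rep ω ≠ g.rep ω}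
  refine hasSum_le_of_sum_le ((law μ f).summable_abs_sub (law μ g)).hasSum fun F => ?_
  have h : ∀ s, |f.mass s - g.mass s| ≤ μ.real (D ∩ f.level s) + μ.real (D ∩ g.level s) := by
    intro s
    have hsub : f.level s ∆ g.level s ⊆ D ∩ f.level s ∪ D ∩ g.level s := by
      rintro ω (⟨h1, h2⟩ | ⟨h1, h2⟩)
      · exact Or.inl ⟨fun he => h2 (he.symm.trans h1), h1⟩
      · exact Or.inr ⟨fun he => h2 (Eq.trans he h1), h1⟩
    refine le_trans (abs_le.2 ⟨?_, ?_⟩) ((measureReal_mono hsub).trans (measureReal_union_le _ _))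
    · rw [f.mass_eq, g.mass_eq, symmDiff_comm]
      linarith [measureReal_sub_le_symmDiff (μ := μ) (g.level s) (f.level s)]
    · rw [f.mass_eq, g.mass_eq]
      exact measureReal_sub_le_symmDiff _ _
  refine (Finset.sum_le_sum fun s _ => h s).trans ?_
  rw [Finset.sum_add_distrib, f.sum_inter_level, g.sum_inter_level, two_mul, RV.dist_eq]
  exact add_le_add (measureReal_mono inter_subset_left) (measureReal_mono inter_subset_left)

theorem continuous_law : Continuous (law (S := S) μ) :=
  LipschitzWith.continuous (K := 2) (LipschitzWith.of_dist_le_mul dist_law_le)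

end Levels

/-! ### Excess mass -/

section Excess

open Set

variable {S : Type v}

/-- The mass by which `β` exceeds `α` at `s`. -/
noncomputable def ProbMass.excess (α β : ProbMass S) (s : S) : ℝ := β.1 s - min (α.1 s) (β.1 s)

theorem ProbMass.excess_nonneg (α β : ProbMass S) (s : S) : 0 ≤ α.excess β s :=
  sub_nonneg.2 (min_le_right _ _)

theorem ProbMass.summable_excess (α β : ProbMass S) : Summable (α.excess β) :=
  Summable.of_nonneg_of_le (α.excess_nonneg β)
    (fun s => sub_le_self _ (le_min (α.2.1 s) (β.2.1 s))) β.2.2.summable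

/-- The mass by which `β` exceeds `α` on the set `A`. -/
noncomputable def ProbMass.excessSum (α β : ProbMass S) (A : Set S) : ℝ :=
  ∑' s, A.indicator (α.excess β) s

theorem ProbMass.excessSum_nonneg (α β : ProbMass S) (A : Set S) : 0 ≤ α.excessSum β A :=
  tsum_nonneg fun s => indicator_nonneg (fun s _ => α.excess_nonneg β s) s

theorem ProbMass.excessSum_mono (α β : ProbMass S) {A A' : Set S} (h : A ⊆ A') :
    α.excessSum β A ≤ α.excessSum β A' :=
  ((α.summable_excess β).indicator A).tsum_le_tsum
    (fun s => indicator_le_indicator_of_subset h (α.excess_nonneg β) s)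
    ((α.summable_excess β).indicator A')

theorem ProbMass.excessSum_Iic [LinearOrder S] (α β : ProbMass S) (s : S) :
    α.excessSum β (Iic s) = α.excessSum β (Iio s) + α.excess β s := by
  have h1 := ((α.summable_excess β).indicator (Iio s)).hasSum.add (hasSum_ite_eq s (α.excess β s))
  refine Eq.trans (tsum_congr fun t => ?_) h1.tsum_eq
  rcases lt_trichotomy t s with h | rfl | h
  · simp [h, h.le, h.ne]
  · simp
  · simp [h.not_ge, h.le, h.ne']

/-- A change of `min` is bounded by the sum of the changes of its arguments, so `β s - min (α s) (β
s)` changes by at most `|α s - α' s| + 2 * |β s - β' s|`, which is summable over all of `S`. -/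
theorem ProbMass.abs_excessSum_sub_le (α β α' β' : ProbMass S) (A : Set S) :
    |α.excessSum β A - α'.excessSum β' A| ≤ dist α α' + 2 * dist β β' := by
  have h := ((α.summable_excess β).indicator A).hasSum.sub
    ((α'.summable_excess β').indicator A).hasSum
  have hb : HasSum (fun s => |α.1 s - α'.1 s| + 2 * |β.1 s - β'.1 s|) (dist α α' + 2 * dist β β') :=
    (α.summable_abs_sub α').hasSum.add ((β.summable_abs_sub β').hasSum.mul_left 2)
  have hp : ∀ s, |A.indicator (α.excess β) s - A.indicator (α'.excess β') s| ≤
      |α.1 s - α'.1 s| + 2 * |β.1 s - β'.1 s| := by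
    intro s
    by_cases hs : s ∈ A
    · simp only [indicator_of_mem hs, ProbMass.excess]
      have hm := abs_min_sub_min_le_max (α.1 s) (β.1 s) (α'.1 s) (β'.1 s)
      have hm' := hm.trans (max_le_add_of_nonneg (abs_nonneg _) (abs_nonneg _))
      have := abs_sub (β.1 s - β'.1 s) (min (α.1 s) (β.1 s) - min (α'.1 s) (β'.1 s))
      rw [sub_sub_sub_comm]
      linarith
    · simp only [indicator_of_notMem hs, sub_self, abs_zero]
      positivity
  refine abs_le.2 ⟨?_, hasSum_le (fun s => (abs_le.1 (hp s)).2) h hb⟩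
  exact hasSum_le (fun s => (abs_le.1 (hp s)).1) hb.neg h

theorem ProbMass.continuous_excessSum (A : Set S) :
    Continuous fun z : ProbMass S × ProbMass S => z.1.excessSum z.2 A := by
  refine continuous_iff_continuousAt.2 fun z => tendsto_iff_dist_tendsto_zero.2 ?_
  refine squeeze_zero (fun _ => dist_nonneg) (fun z' => ProbMass.abs_excessSum_sub_le _ _ _ _ A) ?_
  have : Continuous fun z' : ProbMass S × ProbMass S => dist z'.1 z.1 + 2 * dist z'.2 z.2 := by
    fun_prop
  simpa using this.tendsto z

theorem ProbMass.continuous_apply (s : S) : Continuous fun α : ProbMass S => α.1 s := by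
  refine LipschitzWith.continuous (K := 1) (LipschitzWith.of_dist_le_mul fun α β => ?_)
  rw [NNReal.coe_one, one_mul]
  exact (α.summable_abs_sub β).le_tsum s fun _ _ => abs_nonneg _

end Excess

/-! ### The part of a random variable that is kept -/

section Keep

variable {Ω : Type u} [MeasurableSpace Ω] {μ : Measure Ω} {S : Type v}
  (U : DiffuseCoordinate μ) (f : RV μ S) (β : ProbMass S)

/-- The part of `{f = s}` on which the value `s` is kept in passing from the law of `f` to `β`. -/
noncomputable def keep (s : S) : Set Ω := U.cut (f.level s) (min (f.mass s) (β.1 s))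

theorem measurableSet_keep (s : S) : MeasurableSet (keep U f β s) :=
  U.measurableSet_cut (f.measurableSet_level s) _

theorem measureReal_keep [IsProbabilityMeasure μ] (s : S) :
    μ.real (keep U f β s) = min (f.mass s) (β.1 s) :=
  DiffuseCoordinate.measureReal_cut (le_min (mass_nonneg f s) (β.2.1 s))
    ((min_le_left _ _).trans (f.mass_eq s).le)

/-- The set on which the value of `f` is changed in passing from the law of `f` to `β`. -/
noncomputable def rest : Set Ω :=
  {ω | U.threshold (f.level (f.rep ω)) (min (f.mass (f.rep ω)) (β.1 (f.rep ω))) < U.toFun ω}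

theorem compl_rest_inter (s : S) : (rest U f β)ᶜ ∩ f.level s = keep U f β s := by
  ext ω
  constructor
  · rintro ⟨h1, h2⟩
    have e : f.rep ω = s := h2
    refine ⟨h2, ?_⟩
    have h3 := not_lt.1 (show ¬ U.threshold _ _ < U.toFun ω from h1)
    rwa [e] at h3
  · rintro ⟨h2, h1⟩
    have e : f.rep ω = s := h2
    refine ⟨show ¬ U.threshold _ _ < U.toFun ω from not_lt.2 ?_, h2⟩
    rw [e]
    exact h1

/-- The threshold is an arbitrary function of the value `s`, but every function on `S` is measurable
for the σ-algebra of all subsets. This avoids a possibly uncountable union of kept parts. -/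
theorem measurableSet_rest : MeasurableSet (rest U f β) := by
  have h : @Measurable _ _ ⊤ _ fun s => U.threshold (f.level s) (min (f.mass s) (β.1 s)) :=
    fun _ _ => trivial
  exact measurableSet_lt (h.comp f.measurable_rep) U.measurable_toFun

theorem keep_subset_compl_rest (s : S) : keep U f β s ⊆ (rest U f β)ᶜ := by
  rw [← compl_rest_inter]
  exact Set.inter_subset_left

end Keep

/-! ### Transport of a random variable to a prescribed law -/

section Transport

open Set Filter
open scoped Topology symmDiff

variable {Ω : Type u} [MeasurableSpace Ω] [StandardBorelSpace Ω] {μ : Measure Ω}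
  [IsProbabilityMeasure μ] {S : Type v}

theorem RV.eq_of_level {f g : RV μ S} (h : ∀ s, μ.real (f.level s \ g.level s) = 0) : f = g := by
  rw [← dist_eq_zero, RV.dist_eq]
  refine HasSum.unique (f.hasSum_inter_level _) ?_
  have : ∀ s, μ.real ({ω | f.rep ω ≠ g.rep ω} ∩ f.level s) = 0 := fun s => by
    refine measureReal_mono_null (fun ω hω => ?_) (h s)
    exact ⟨hω.2, fun h' => hω.1 (Eq.trans hω.2 (Eq.symm h'))⟩
  simp only [this, hasSum_zero]

theorem ProbMass.nonempty (β : ProbMass S) : Nonempty S := by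
  by_contra h
  have := not_nonempty_iff.1 h
  exact zero_ne_one (hasSum_empty.unique β.2.2)

/-- A disjoint family of sets of total measure `1` is the family of level sets of a random
variable. -/
theorem exists_rv_of_disjoint (β : ProbMass S) {Q : S → Set Ω} (hQ : ∀ s, MeasurableSet (Q s))
    (hd : ∀ s t, s ≠ t → Disjoint (Q s) (Q t)) (hm : ∀ s, μ.real (Q s) = β.1 s) :
    ∃ g : RV μ S, law μ g = β ∧ ∀ s, μ.real (Q s ∆ g.level s) = 0 := by
  classical
  obtain ⟨s₀⟩ := β.nonempty
  have hT : (Function.support β.1).Countable := β.2.2.summable.countable_support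
  -- Only the countably many `Q s` with `β s ≠ 0` are used, so that preimages are countable unions;
  -- `s₀` is a default value on the leftover null set.
  let f : Ω → S := fun ω => if h : ∃ s ∈ Function.support β.1, ω ∈ Q s then h.choose else s₀
  have hf : ∀ s ∈ Function.support β.1, ∀ ω ∈ Q s, f ω = s := by
    intro s hs ω hω
    have h : ∃ s ∈ Function.support β.1, ω ∈ Q s := ⟨s, hs, hω⟩
    simp only [f, dif_pos h]
    by_contra hne
    exact (disjoint_left.1 (hd _ _ hne)) h.choose_spec.2 hω
  have hf' : ∀ ω, (∃ s ∈ Function.support β.1, ω ∈ Q s) ∨ f ω = s₀ := by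
    intro ω
    by_cases h : ∃ s ∈ Function.support β.1, ω ∈ Q s
    · exact Or.inl h
    · exact Or.inr (dif_neg h)
  have hU : ∀ A : Set S, MeasurableSet (⋃ s ∈ Function.support β.1 ∩ A, Q s) := fun A =>
    MeasurableSet.biUnion (hT.mono inter_subset_left) fun s _ => hQ s
  have hfU : ∀ A : Set S, s₀ ∉ A → f ⁻¹' A = ⋃ s ∈ Function.support β.1 ∩ A, Q s := by
    intro A hA
    ext ω
    simp only [mem_preimage, mem_iUnion, exists_prop]
    constructor
    · intro h
      rcases hf' ω with ⟨s, hs, hω⟩ | h0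
      · exact ⟨s, ⟨hs, hf s hs ω hω ▸ h⟩, hω⟩
      · exact absurd (h0 ▸ h) hA
    · rintro ⟨s, ⟨hs, hsA⟩, hω⟩
      rwa [hf s hs ω hω]
  have hmeas : Measurable[_, ⊤] f := by
    intro A _
    -- The default value spoils the description as a union when `s₀ ∈ A`; the complement of `A` is
    -- then used.
    by_cases hA : s₀ ∈ A
    · have := (hU Aᶜ).compl
      rwa [← hfU Aᶜ (not_not.2 hA), preimage_compl, compl_compl] at this
    · rw [hfU A hA]
      exact hU A
  set g := RV.mk μ f hmeas
  have h1 : ∀ s, μ.real (Q s \ g.level s) = 0 := by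
    intro s
    by_cases hs : s ∈ Function.support β.1
    · have hsub : Q s \ g.level s ⊆ {ω | ¬ g.rep ω = f ω} := fun ω hω h =>
        hω.2 (h.trans (hf s hs ω hω.1))
      exact measureReal_mono_null hsub (by
        rw [measureReal_eq_zero_iff]
        exact ae_iff.1 (RV.rep_mk hmeas))
    · exact measureReal_mono_null sdiff_subset ((hm s).trans (Function.notMem_support.1 hs))
  have h2 : ∀ s, μ.real (Q s ∩ g.level s) = β.1 s := fun s => by
    have := measureReal_sdiff_add_inter (μ := μ) (s := Q s) (g.measurableSet_level s)
    rw [h1, hm] at this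
    linarith
  have h3 : ∀ s, β.1 s ≤ g.mass s := fun s => by
    rw [← h2, g.mass_eq]
    exact measureReal_mono inter_subset_right
  -- The mass of `g` dominates `β` pointwise and both sum to `1`.
  have h4 : g.mass = β.1 := by
    have h := (hasSum_mass g).sub β.2.2
    rw [sub_self, hasSum_zero_iff_of_nonneg fun s => sub_nonneg.2 (h3 s)] at h
    exact funext fun s => sub_eq_zero.1 (congrFun h s)
  refine ⟨g, Subtype.ext h4, fun s => measureReal_union_null (h1 s) ?_⟩
  have := measureReal_sdiff_add_inter (μ := μ) (s := g.level s) (hQ s)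
  rw [inter_comm, h2, ← g.mass_eq, h4] at this
  linarith

variable (U : DiffuseCoordinate μ) (f : RV μ S) (β : ProbMass S)

/-- The kept parts have total measure `∑ min (f.mass s) (β s)`, and `β` has total mass `1`. Hence
the rest has exactly the room needed for the excess. -/
theorem measureReal_rest : μ.real (rest U f β) = (law μ f).excessSum β univ := by
  have h := f.hasSum_inter_level (rest U f β)ᶜ
  simp only [compl_rest_inter, measureReal_keep] at h
  have h' := β.2.2.sub h
  rw [probReal_compl_eq_one_sub (measurableSet_rest U f β), sub_sub_cancel] at h'
  rw [ProbMass.excessSum, indicator_univ]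
  exact h'.tsum_eq.symm

theorem excessSum_le_rest (A : Set S) : (law μ f).excessSum β A ≤ μ.real (rest U f β) := by
  rw [measureReal_rest]
  exact ProbMass.excessSum_mono _ _ (subset_univ A)

variable {X : Type*} {l : Filter X} {F : X → RV μ S} {b : X → ProbMass S} {f β}

theorem tendsto_mass (hF : Tendsto F l (𝓝 f)) (s : S) :
    Tendsto (fun x => (F x).mass s) l (𝓝 (f.mass s)) :=
  ((ProbMass.continuous_apply s).comp continuous_law).continuousAt.tendsto.comp hF

theorem setTendsto_keep (hF : Tendsto F l (𝓝 f)) (hb : Tendsto b l (𝓝 β)) (s : S) :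
    SetTendsto μ (fun x => keep U (F x) (b x) s) l (keep U f β s) :=
  DiffuseCoordinate.setTendsto_cut (fun x => (F x).measurableSet_level s) (f.measurableSet_level s)
    (fun x => le_min (mass_nonneg _ s) ((b x).2.1 s))
    (fun x => (min_le_left _ _).trans ((F x).mass_eq s).le)
    (le_min (mass_nonneg _ s) (β.2.1 s)) ((min_le_left _ _).trans (f.mass_eq s).le)
    (RV.setTendsto_level hF s)
    ((tendsto_mass hF s).min (((ProbMass.continuous_apply s).tendsto β).comp hb))

theorem tendsto_excessSum (hF : Tendsto F l (𝓝 f)) (hb : Tendsto b l (𝓝 β)) (A : Set S) :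
    Tendsto (fun x => (law μ (F x)).excessSum (b x) A) l (𝓝 ((law μ f).excessSum β A)) :=
  ((ProbMass.continuous_excessSum A).tendsto (law μ f, β)).comp
    (((continuous_law.tendsto f).comp hF).prodMk_nhds hb)

/-- On each level set of `f`, a point that newly enters the rest has left the kept part, so that
difference is controlled level by level. The opposite difference follows because the measures of the
rests converge. -/
theorem setTendsto_rest (hF : Tendsto F l (𝓝 f)) (hb : Tendsto b l (𝓝 β)) :
    SetTendsto μ (fun x => rest U (F x) (b x)) l (rest U f β) := by
  have h1 : Tendsto (fun x => μ.real (rest U (F x) (b x) \ rest U f β)) l (𝓝 0) := by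
    refine f.tendsto_measureReal_zero fun s => ?_
    refine tendsto_measureReal_zero_of_subset (setTendsto_keep U hF hb s).diff_right
      fun x ω hω => ⟨?_, fun h => keep_subset_compl_rest U (F x) (b x) s h hω.1.1⟩
    rw [← compl_rest_inter]
    exact ⟨hω.1.2, hω.2⟩
  refine SetTendsto.of_diff h1 ?_
  have h2 := ((tendsto_excessSum hF hb univ).const_sub ((law μ f).excessSum β univ)).add h1
  rw [sub_self, zero_add] at h2
  refine h2.congr fun x => ?_
  have e1 := measureReal_sdiff_add_inter (μ := μ) (s := rest U (F x) (b x))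
    (measurableSet_rest U f β)
  have e2 := measureReal_sdiff_add_inter (μ := μ) (s := rest U f β)
    (measurableSet_rest U (F x) (b x))
  rw [inter_comm] at e2
  rw [measureReal_rest] at e1 e2
  linarith

variable (f β) [LinearOrder S]

/-- The part of `rest U f β` on which the value of `f` is replaced by `s`. -/
noncomputable def fill (s : S) : Set Ω :=
  U.cut (rest U f β) ((law μ f).excessSum β (Iic s)) \
    U.cut (rest U f β) ((law μ f).excessSum β (Iio s))

/-- The set on which the transported random variable takes the value `s`. -/
noncomputable def target (s : S) : Set Ω := keep U f β s ∪ fill U f β s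

theorem measurableSet_fill (s : S) : MeasurableSet (fill U f β s) :=
  (U.measurableSet_cut (measurableSet_rest U f β) _).diff
    (U.measurableSet_cut (measurableSet_rest U f β) _)

theorem measurableSet_target (s : S) : MeasurableSet (target U f β s) :=
  (measurableSet_keep U f β s).union (measurableSet_fill U f β s)

theorem measureReal_fill (s : S) : μ.real (fill U f β s) = (law μ f).excess β s := by
  rw [fill, measureReal_sdiff (DiffuseCoordinate.cut_mono (ProbMass.excessSum_nonneg _ _ _)
      (ProbMass.excessSum_mono _ _ Iio_subset_Iic_self) (excessSum_le_rest U f β _))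
      (U.measurableSet_cut (measurableSet_rest U f β) _),
    DiffuseCoordinate.measureReal_cut (ProbMass.excessSum_nonneg _ _ _) (excessSum_le_rest U f β _),
    DiffuseCoordinate.measureReal_cut (ProbMass.excessSum_nonneg _ _ _) (excessSum_le_rest U f β _),
    ProbMass.excessSum_Iic, add_sub_cancel_left]

theorem fill_subset_rest (s : S) : fill U f β s ⊆ rest U f β :=
  sdiff_subset.trans (U.cut_subset _ _)

theorem disjoint_keep_fill (s t : S) : Disjoint (keep U f β s) (fill U f β t) :=
  disjoint_compl_left.mono (keep_subset_compl_rest U f β s) (fill_subset_rest U f β t)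

/-- The slice of `s` ends at the cumulative excess over `Iic s ⊆ Iio t`, hence lies in the initial
part removed from the slice of `t`. -/
theorem disjoint_fill {s t : S} (h : s < t) : Disjoint (fill U f β s) (fill U f β t) := by
  refine disjoint_sdiff_right.mono_left (sdiff_subset.trans ?_)
  exact DiffuseCoordinate.cut_mono (ProbMass.excessSum_nonneg _ _ _)
    (ProbMass.excessSum_mono _ _ (Iic_subset_Iio.2 h)) (excessSum_le_rest U f β _)

theorem disjoint_target (s t : S) (h : s ≠ t) :
    Disjoint (target U f β s) (target U f β t) := by
  refine disjoint_union_left.2 ⟨disjoint_union_right.2 ⟨?_, disjoint_keep_fill U f β s t⟩,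
    disjoint_union_right.2 ⟨(disjoint_keep_fill U f β t s).symm, ?_⟩⟩
  · exact (f.disjoint_level h).mono (U.cut_subset _ _) (U.cut_subset _ _)
  · rcases lt_or_gt_of_ne h with h | h
    · exact disjoint_fill U f β h
    · exact (disjoint_fill U f β h).symm

theorem measureReal_target (s : S) : μ.real (target U f β s) = β.1 s := by
  rw [target, measureReal_union (disjoint_keep_fill U f β s s) (measurableSet_fill U f β s),
    measureReal_keep, measureReal_fill]
  exact add_sub_cancel _ _

theorem exists_transport : ∃ g : RV μ S, law μ g = β ∧
    ∀ s, μ.real (target U f β s ∆ g.level s) = 0 :=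
  exists_rv_of_disjoint β (measurableSet_target U f β) (disjoint_target U f β)
    (measureReal_target U f β)

/-- A random variable with law `β` that agrees with `f` as often as possible, and depends
continuously on `f` and `β`. -/
noncomputable def transport : RV μ S := (exists_transport U f β).choose

theorem law_transport : law μ (transport U f β) = β := (exists_transport U f β).choose_spec.1

theorem target_symmDiff_level (s : S) :
    μ.real (target U f β s ∆ (transport U f β).level s) = 0 :=
  (exists_transport U f β).choose_spec.2 s

/-- With `β = law f` the minimum is `f.mass s`, so each level set is kept up to a null set. -/
theorem transport_law : transport U f (law μ f) = f := by
  refine (RV.eq_of_level fun s => ?_).symm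
  have h1 : μ.real (f.level s \ keep U f (law μ f) s) = 0 := by
    rw [measureReal_sdiff (show keep U f (law μ f) s ⊆ f.level s from U.cut_subset _ _)
      (measurableSet_keep U f _ s), measureReal_keep, ← f.mass_eq]
    exact sub_eq_zero.2 (min_self _).symm
  refine measureReal_mono_null (fun ω hω => ?_)
    (measureReal_union_null h1 (target_symmDiff_level U f (law μ f) s))
  by_cases h : ω ∈ keep U f (law μ f) s
  · exact Or.inr (Or.inl ⟨Or.inl h, hω.2⟩)
  · exact Or.inl ⟨hω.1, h⟩

variable {f β}

theorem setTendsto_fill (hF : Tendsto F l (𝓝 f)) (hb : Tendsto b l (𝓝 β)) (s : S) :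
    SetTendsto μ (fun x => fill U (F x) (b x) s) l (fill U f β s) := by
  have h : ∀ A : Set S, SetTendsto μ
      (fun x => U.cut (rest U (F x) (b x)) ((law μ (F x)).excessSum (b x) A)) l
      (U.cut (rest U f β) ((law μ f).excessSum β A)) := fun A =>
    DiffuseCoordinate.setTendsto_cut (fun x => measurableSet_rest U _ _) (measurableSet_rest U _ _)
      (fun x => ProbMass.excessSum_nonneg _ _ _) (fun x => excessSum_le_rest U _ _ _)
      (ProbMass.excessSum_nonneg _ _ _) (excessSum_le_rest U _ _ _) (setTendsto_rest U hF hb)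
      (tendsto_excessSum hF hb A)
  exact (h _).sdiff (h _)

/-- The choice in `transport` is harmless: its level sets are the sets `target` up to null sets, and
those converge. -/
theorem tendsto_transport (hF : Tendsto F l (𝓝 f)) (hb : Tendsto b l (𝓝 β)) :
    Tendsto (fun x => transport U (F x) (b x)) l (𝓝 (transport U f β)) := by
  refine RV.tendsto_of_level fun s => ?_
  refine squeeze_zero (fun _ => measureReal_nonneg) (fun x => ?_)
    ((setTendsto_keep U hF hb s).union (setTendsto_fill U hF hb s))
  refine (measureReal_symmDiff_le (t := target U (F x) (b x) s) _).trans ?_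
  rw [symmDiff_comm, target_symmDiff_level, zero_add]
  refine (measureReal_symmDiff_le (t := target U f β s) _).trans ?_
  rw [target_symmDiff_level, add_zero]
  exact le_rfl

theorem continuous_transport :
    Continuous fun z : RV μ S × ProbMass S => transport U z.1 z.2 :=
  continuous_iff_continuousAt.2 fun _ =>
    tendsto_transport U (continuous_fst.tendsto _) (continuous_snd.tendsto _)

end Transport

/-! ### Contractions of the space of random variables -/

section Contraction

open Set Filter
open scoped Topology symmDiff unitInterval

variable {Ω : Type u} [MeasurableSpace Ω] {μ : Measure Ω} [IsProbabilityMeasure μ] {S : Type v}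
  (U : DiffuseCoordinate μ)

/-- Sublevel sets are nested, so the symmetric difference has measure the difference of two values
of a continuous function. -/
theorem DiffuseCoordinate.tendsto_measureReal_symmDiff (t : I) :
    Tendsto (fun t' : I => μ.real ((U.toFun ⁻¹' Iic (t' : ℝ)) ∆ (U.toFun ⁻¹' Iic (t : ℝ)))) (𝓝 t)
      (𝓝 0) := by
  have hc : Continuous fun t' : I => μ.real (U.toFun ⁻¹' Iic (t' : ℝ)) := by
    have h := (U.continuousOn_measureReal_inter univ).comp_continuous continuous_subtype_val
      fun t' : I => t'.2
    simp only [univ_inter] at h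
    exact h
  have h := ((hc.tendsto t).sub_const (μ.real (U.toFun ⁻¹' Iic (t : ℝ)))).abs
  rw [sub_self, abs_zero] at h
  refine h.congr fun t' => ?_
  rcases le_total t t' with ht | ht
  · have hs : U.toFun ⁻¹' Iic (t : ℝ) ⊆ U.toFun ⁻¹' Iic (t' : ℝ) :=
      preimage_mono (Iic_subset_Iic.2 ht)
    rw [symmDiff_of_ge hs, measureReal_sdiff hs (U.measurableSet_le _),
      abs_of_nonneg (sub_nonneg.2 (measureReal_mono hs))]
  · have hs : U.toFun ⁻¹' Iic (t' : ℝ) ⊆ U.toFun ⁻¹' Iic (t : ℝ) :=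
      preimage_mono (Iic_subset_Iic.2 ht)
    rw [symmDiff_of_le hs, measureReal_sdiff hs (U.measurableSet_le _), abs_sub_comm,
      abs_of_nonneg (sub_nonneg.2 (measureReal_mono hs))]

/-- The space of all random variables contracts to each of its points. -/
theorem exists_contraction (U : DiffuseCoordinate μ) (g : RV μ S) : ∃ c : C(I × RV μ S, RV μ S),
    (∀ f, c (0, f) = f) ∧ (∀ f, c (1, f) = g) ∧ ∀ t, c (t, g) = g := by
  classical
  -- Replace `f` by `g` on `{U ≤ t}`, which is empty for `t = 0` and everything for `t = 1`, as `0 <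
  -- U < 1`.
  let c : I → RV μ S → Ω → S := fun t f => (U.toFun ⁻¹' Iic (t : ℝ)).piecewise g.rep f.rep
  have hc : ∀ t f, Measurable[_, ⊤] (c t f) := fun t f =>
    Measurable.piecewise (U.measurableSet_le _) g.measurable_rep f.measurable_rep
  refine ⟨⟨fun z => RV.mk μ (c z.1 z.2) (hc _ _), ?_⟩, fun f => ?_, fun f => ?_, fun t => ?_⟩
  · refine continuous_iff_continuousAt.2 fun z => tendsto_iff_dist_tendsto_zero.2 ?_
    have hd : Tendsto (fun z' : I × RV μ S => dist z'.2 z.2) (𝓝 z) (𝓝 0) := by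
      have : Continuous fun z' : I × RV μ S => dist z'.2 z.2 := by fun_prop
      simpa using this.tendsto z
    have h := ((U.tendsto_measureReal_symmDiff z.1).comp (continuous_fst.tendsto z)).add hd
    rw [add_zero] at h
    refine squeeze_zero (fun _ => dist_nonneg) (fun z' => ?_) h
    rw [RV.dist_mk, RV.dist_eq]
    refine (measureReal_mono (fun ω hω => ?_)).trans (measureReal_union_le _ _)
    by_contra hn
    simp only [mem_union, not_or, mem_symmDiff, mem_ofPred_eq, not_not, not_and] at hn
    refine hω ?_
    by_cases h1 : ω ∈ U.toFun ⁻¹' Iic (z.1 : ℝ)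
    · have h2 : ω ∈ U.toFun ⁻¹' Iic (z'.1 : ℝ) := hn.1.2 h1
      simp only [c, piecewise_eq_of_mem _ _ _ h1, piecewise_eq_of_mem _ _ _ h2]
    · have h2 : ω ∉ U.toFun ⁻¹' Iic (z'.1 : ℝ) := fun h2 => h1 (hn.1.1 h2)
      simp only [c, piecewise_eq_of_notMem _ _ _ h1, piecewise_eq_of_notMem _ _ _ h2, hn.2]
  · have e : c 0 f = f.rep := funext fun ω =>
      piecewise_eq_of_notMem _ _ _ (not_le.2 (U.pos ω))
    exact (by simp only [e] : RV.mk μ (c 0 f) (hc 0 f) = _).trans f.mk_rep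
  · have e : c 1 f = g.rep := funext fun ω =>
      piecewise_eq_of_mem _ _ _ (U.lt_one ω).le
    exact (by simp only [e] : RV.mk μ (c 1 f) (hc 1 f) = _).trans g.mk_rep
  · have e : c t g = g.rep := piecewise_same _ _
    exact (by simp only [e] : RV.mk μ (c t g) (hc t g) = _).trans g.mk_rep

end Contraction

/-! ### Random variables with law in the realization -/

section Closure

open Set Filter
open scoped Topology

variable {Ω : Type u} [MeasurableSpace Ω] [StandardBorelSpace Ω] {μ : Measure Ω}
  [IsProbabilityMeasure μ] {S : Type v} (K : PreAbstractSimplicialComplex S)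

theorem mem_spaceL_of_law {f : RV μ S} (h : law μ f ∈ realization K) : f ∈ spaceL μ K := by
  obtain ⟨F, hF, e⟩ := h
  exact ⟨F, hF, e.trans (law_support μ f)⟩

/-- Finitely many values of positive mass form a face and carry all but `ε` of `Ω`; moving
everything else to one of them gives a nearby element of `L(Ω, K)`. -/
theorem mem_spaceLbar_of_law {f : RV μ S} (h : law μ f ∈ realizationBar K) :
    f ∈ spaceLbar μ K := by
  classical
  refine Metric.mem_closure_iff.2 fun ε hε => ?_
  -- The bound by `1` forces the set of retained values to be nonempty.
  obtain ⟨F₀, hF₀⟩ := ((tendsto_order.1 f.tendsto_compl).2 (min ε 1) (lt_min hε one_pos)).exists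
  set F := F₀.filter fun s => 0 < f.mass s
  have hpos : ∀ s ∈ F, 0 < f.mass s := fun s hs => (Finset.mem_filter.1 hs).2
  have hF : μ.real (f.rep ⁻¹' F)ᶜ < min ε 1 := by
    rw [probReal_compl_eq_one_sub (f.measurable_rep trivial), ← f.sum_mass] at hF₀ ⊢
    rwa [Finset.sum_filter_of_ne]
    exact fun s _ hs => lt_of_le_of_ne (mass_nonneg f s) hs.symm
  have hne : F.Nonempty := by
    refine Finset.nonempty_iff_ne_empty.2 fun h0 => ?_
    rw [h0] at hF
    simp at hF
  obtain ⟨s₀, hs₀⟩ := hne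
  have hmeas : Measurable[_, ⊤] ((f.rep ⁻¹' F).piecewise f.rep fun _ => s₀) :=
    Measurable.piecewise (f.measurable_rep trivial) f.measurable_rep measurable_const
  refine ⟨RV.mk μ _ hmeas, ⟨F, h F ⟨s₀, hs₀⟩ ?_, ?_⟩, ?_⟩
  · exact fun s hs => (hpos s hs).ne'
  · ext s
    change s ∈ F ↔ 0 < μ.real _
    constructor
    · intro hs
      refine (hpos s hs).trans_le ?_
      rw [f.mass_eq]
      refine measureReal_mono fun ω hω => ?_
      have e : f.rep ω = s := hω
      have hω' : ω ∈ f.rep ⁻¹' F := by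
        change f.rep ω ∈ F
        rwa [e]
      exact Eq.trans (piecewise_eq_of_mem (f.rep ⁻¹' F) f.rep (fun _ => s₀) hω') e
    · intro hs
      by_contra hn
      refine hs.ne' ?_
      convert measureReal_empty (μ := μ)
      refine eq_empty_of_forall_notMem fun ω hω => hn ?_
      have hω' : (f.rep ⁻¹' F).piecewise f.rep (fun _ => s₀) ω = s := hω
      by_cases hm : ω ∈ f.rep ⁻¹' F
      · rw [piecewise_eq_of_mem _ _ _ hm] at hω'
        exact hω' ▸ hm
      · rw [piecewise_eq_of_notMem _ _ _ hm] at hω'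
        exact hω' ▸ hs₀
  · refine (congrArg (dist · _) f.mk_rep.symm).trans_lt ?_
    rw [RV.dist_mk]
    refine (measureReal_mono ?_).trans_lt (hF.trans_le (min_le_left _ _))
    refine fun ω hω hm => hω ?_
    exact (piecewise_eq_of_mem _ _ _ hm).symm

end Closure

end SimplicialRV

/-- The law maps have the homotopy lifting property for all spaces and are homotopy equivalences,
whether or not the complex is finite, because every random variable can be transported
continuously to every law. -/
theorem mainTheorem2 {Ω : Type u} [MeasurableSpace Ω] [StandardBorelSpace Ω]
    (μ : Measure Ω) [IsProbabilityMeasure μ] [NullSingletonClass μ]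
    {S : Type v} (K : PreAbstractSimplicialComplex S) :
    (SimplicialRV.IsSerreFibration (SimplicialRV.lawMap μ K) ∧
      SimplicialRV.IsWeakHomotopyEquiv (SimplicialRV.lawMap μ K) ∧
      SimplicialRV.IsSerreFibration (SimplicialRV.lawMapBar μ K) ∧
      SimplicialRV.IsWeakHomotopyEquiv (SimplicialRV.lawMapBar μ K)) ∧
    (K.faces.Finite →
      SimplicialRV.IsHurewiczFibration.{_, _, w} (SimplicialRV.lawMap μ K) ∧
      SimplicialRV.IsHomotopyEquiv (SimplicialRV.lawMap μ K) ∧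
      SimplicialRV.IsHurewiczFibration.{_, _, w} (SimplicialRV.lawMapBar μ K) ∧
      SimplicialRV.IsHomotopyEquiv (SimplicialRV.lawMapBar μ K)) := by
  open SimplicialRV in
  classical
  -- Any linear order would serve: it only fixes the order in which the rest is sliced.
  let _ : LinearOrder S := linearOrderOfSTO WellOrderingRel
  obtain ⟨U⟩ := nonempty_diffuseCoordinate μ
  have hT := continuous_transport (S := S) U
  have key : ∀ {A : Set (RV μ S)} {C : Set (ProbMass S)} (h : Set.MapsTo (law μ) A C)
      (_ : ∀ f, law μ f ∈ C → f ∈ A),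
      (IsSerreFibration h.restrict ∧ IsWeakHomotopyEquiv h.restrict) ∧
        IsHurewiczFibration.{_, _, w} h.restrict ∧ IsHomotopyEquiv h.restrict := by
    intro A C h hA
    have hp : Continuous h.restrict := continuous_law.restrict h
    have hD := hasPointedDeformation_restrict continuous_law hT
      (fun f β => law_transport U f β) (fun f => transport_law U f) (exists_contraction U) h hA
    -- A constant random variable transported to the law `β` is a preimage of `β`.
    have hne : Nonempty C → Nonempty A := by
      rintro ⟨β, hβ⟩
      obtain ⟨s⟩ := β.nonempty
      exact ⟨transport U (RV.mk μ (fun _ => s) measurable_const) β,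
        hA _ (by rwa [law_transport])⟩
    exact ⟨⟨⟨hp, fun n => hasHLP_restrict hT (fun f β => law_transport U f β)
        (fun f => transport_law U f) h hA _⟩,
      hD.isWeakHomotopyEquiv hp hne⟩,
      ⟨hp, fun X _ => hasHLP_restrict hT (fun f β => law_transport U f β)
        (fun f => transport_law U f) h hA X⟩, hD.isHomotopyEquiv hp hne⟩
  have h1 := key (mapsTo_law μ K) fun f => mem_spaceL_of_law K
  have h2 := key (mapsTo_law_bar μ K) fun f => mem_spaceLbar_of_law K
  exact ⟨⟨h1.1.1, h1.1.2, h2.1.1, h2.1.2⟩, fun _ => ⟨h1.2.1, h1.2.2, h2.2.1, h2.2.2⟩⟩
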